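/- Notation. Let $\mathcal D$ be the set of continuous functions $f:\mathbb R^3\to[0,\infty)$ whose support $K_f$ is compact and connected, has the origin in its interior, and has as boundary a finite disjoint union of compact connected $2$-dimensional topological submanifolds of $\mathbb R^3$ (without boundary). For $f\in\mathcal D$ put $M=\int_{\mathbb R^3} f$ and $R(f)=\inf\{m : K_f\subset B_m(\mathbf 0)\}$, and let $\bar Y_{n,m}$ ($n\ge 0$, $|m|\le n$) be the fully normalized real spherical harmonics (their squares have mean $1$ over the unit sphere). With the gravitational constant $G>0$, the spherical harmonic expansion about infinity of the gravitational potential $V_f(\mathbf x)=G\int f(\mathbf y)\,\|\mathbf x-\mathbf y\|^{-1}d\mathbf y$ is, with $R=R(f)$, \[ SHE(V_f)(r,\theta,\phi)=\frac{GM}{R}\sum_{n=0}^{\infty}\sum_{m=-n}^{n}\Big(\frac{R}{r}\Big)^{n+1}C_{n,m}\,\bar Y_{n,m}(\theta,\phi),\qquad C_{n,m}=\frac{1}{(2n+1)M}\int_{\mathbb R^3}\Big(\frac{\|\mathbf y\|}{R}\Big)^{n}\bar Y_{n,m}\Big(\frac{\mathbf y}{\|\mathbf y\|}\Big)f(\mathbf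 y)\,d\mathbf y , \] where convergence refers to the partial sums over the degree $n$. Put \[ R_c(f)=\inf\{r>0 : SHE(V_f)\text{ converges uniformly on }\mathbb R^3\setminus\overline B_r(\mathbf 0)\}. \] For $\varepsilon>0$, say that $f\in\mathcal D$ has the $\varepsilon$-descent property if $SHE(V_f)$ converges uniformly on the set of points $\mathbf x$ of the unbounded component of $\mathbb R^3\setminus K_f$ with $R(f)-\varepsilon<\|\mathbf x\|<R(f)$. For $1\le p<\infty$ and a weight $w$, i.e. a continuous function $w:\mathbb R^3\to(0,\infty)$, the $L^{p,w}$-topology on $\mathcal D$ is the one induced by the metric $\mu_{p,w}(f,g)=\big(\int_{\mathbb R^3}|f-g|^p\,w\,d\mathbf x\big)^{1/p}$. Corollary 2. For every $\varepsilon>0$, $1\le p<\infty$ and weight $w$, the restriction of $R_c$ to the set of all $f\in\mathcal D$ with the $\varepsilon$-descent property, with the topology induced by the $L^{p,w}$-topology, is discontinuous at every point of this set. The same holds for the restriction of $R_c$ to $\{f\in\mathcal D : R_c(f)\le R(f)-\varepsilon\}$. -/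

import Mathlib

open MeasureTheory Filter Set

noncomputable section

/-- Euclidean three-space. -/
abbrev E3 : Type := EuclideanSpace ℝ (Fin 3)

/-! ### Mass densities -/

/-- A compact connected two-dimensional topological submanifold (without boundary) of `ℝ³`:
with the subspace topology it is locally homeomorphic to `ℝ²`. -/
def IsClosedSurface (S : Set E3) : Prop :=
  IsCompact S ∧ IsConnected S ∧ Nonempty (ChartedSpace (EuclideanSpace ℝ (Fin 2)) S)

/-- The mass densities of planets: continuous nonnegative functions whose support is compact and
connected, has the origin in its interior, and has as its boundary a finite disjoint union of
closed surfaces. -/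
structure IsDensity (f : E3 → ℝ) : Prop where
  continuous : Continuous f
  nonneg : ∀ x, 0 ≤ f x
  compact_support : HasCompactSupport f
  connected_support : IsConnected (tsupport f)
  boundary : ∃ 𝒮 : Set (Set E3), 𝒮.Finite ∧ 𝒮.PairwiseDisjoint id ∧
    (∀ S ∈ 𝒮, IsClosedSurface S) ∧ ⋃₀ 𝒮 = frontier (tsupport f)
  zero_mem : (0 : E3) ∈ interior (tsupport f)

/-- The space of mass densities of planets. -/
def Density : Type := {f : E3 → ℝ // IsDensity f}

/-- The Brillouin radius: the infimum of the radii of the balls about the origin that contain the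
support of `f`. -/
def brillouinRadius (f : E3 → ℝ) : ℝ :=
  sInf {m : ℝ | tsupport f ⊆ Metric.ball (0 : E3) m}

/-- The total mass. -/
def totalMass (f : E3 → ℝ) : ℝ := ∫ y, f y

/-- The free space above the topography of a compact set `K`: the unbounded component of the
complement of `K`. -/
def freeSpace (K : Set E3) : Set E3 :=
  {x | x ∈ Kᶜ ∧ ¬ Bornology.IsBounded (connectedComponentIn Kᶜ x)}

/-! ### Weighted `L^p` metrics -/

/-- The `w`-weighted `L^p` norm `(∫ |f|^p w)^(1/p)`. -/
def wLpNorm (p : ℝ) (w f : E3 → ℝ) : ℝ :=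
  (∫ x, |f x| ^ p * w x) ^ (1 / p)

/-- The weighted norm as an unweighted one. -/
theorem wLpNorm_eq {p : ℝ} (hp : 1 ≤ p) {w f : E3 → ℝ} (hw : Continuous w)
    (hw0 : ∀ x, 0 < w x) (hf : Continuous f) (hfc : HasCompactSupport f) :
    MemLp (fun x => f x * w x ^ (1 / p)) (ENNReal.ofReal p) volume ∧
    wLpNorm p w f = (eLpNorm (fun x => f x * w x ^ (1 / p)) (ENNReal.ofReal p) volume).toReal := by
  have hp0 : 0 < p := by linarith
  have hc : Continuous (fun x => f x * w x ^ (1 / p)) :=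
    hf.mul (hw.rpow_const (fun x => Or.inl (hw0 x).ne'))
  have hm : MemLp (fun x => f x * w x ^ (1 / p)) (ENNReal.ofReal p) volume :=
    hc.memLp_of_hasCompactSupport hfc.mul_right
  refine ⟨hm, ?_⟩
  rw [hm.eLpNorm_eq_integral_rpow_norm (by simpa using hp0) ENNReal.ofReal_ne_top,
    ENNReal.toReal_ofReal hp0.le, ENNReal.toReal_ofReal (by positivity), wLpNorm, one_div]
  congr 1
  refine integral_congr_ae (Eventually.of_forall fun x => ?_)
  have h1 : 0 ≤ w x ^ p⁻¹ := Real.rpow_nonneg (hw0 x).le _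
  simp only [norm_mul, Real.norm_eq_abs]
  rw [abs_of_nonneg h1, Real.mul_rpow (abs_nonneg _) h1, ← Real.rpow_mul (hw0 x).le,
    inv_mul_cancel₀ hp0.ne', Real.rpow_one]

/-- The metric `μ_{p,w}(f, g) = ‖f - g‖_{p,w}` on the space of densities, which induces the
`L^{p,w}`-topology. -/
@[reducible] def wLpMetric (p : ℝ) (hp : 1 ≤ p) (w : E3 → ℝ) (hw : Continuous w)
    (hw0 : ∀ x, 0 < w x) : PseudoMetricSpace Density where
  dist f g := wLpNorm p w (fun x => f.1 x - g.1 x)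
  dist_self f := by
    have hp0 : p ≠ 0 := by linarith
    simp [wLpNorm, hp0]
  dist_comm f g := by simp only [wLpNorm, abs_sub_comm]
  dist_triangle f g h := by
    have key : ∀ a b : Density, _ := fun a b =>
      wLpNorm_eq hp hw hw0 (a.2.continuous.sub b.2.continuous)
        (a.2.compact_support.sub b.2.compact_support)
    obtain ⟨m1, e1⟩ := key f g
    obtain ⟨m2, e2⟩ := key g h
    obtain ⟨m3, e3⟩ := key f h
    simp only [Pi.sub_apply] at m1 e1 m2 e2 m3 e3
    erw [e1, e2, e3]
    rw [← ENNReal.toReal_add m1.2.ne m2.2.ne]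
    refine ENNReal.toReal_mono (ENNReal.add_ne_top.2 ⟨m1.2.ne, m2.2.ne⟩) ?_
    refine le_trans (le_of_eq ?_) (eLpNorm_add_le m1.1 m2.1 (by simpa using hp))
    congr 1
    funext x
    simp only [Pi.add_apply]
    ring

/-! ### Spherical harmonic expansions -/

/-- The Legendre polynomial of degree `n`, by Rodrigues' formula. -/
def legendrePoly (n : ℕ) : Polynomial ℝ :=
  Polynomial.C (1 / (2 ^ n * (n.factorial : ℝ))) *
    Polynomial.derivative^[n] ((Polynomial.X ^ 2 - 1) ^ n)

/-- The fully normalized associated Legendre function of degree `n` and order `m ≤ n`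
(without the Condon-Shortley sign, as usual in geodesy). -/
def assocLegendre (n m : ℕ) (t : ℝ) : ℝ :=
  √((if m = 0 then 1 else 2) * (2 * n + 1) * ((n - m).factorial / (n + m).factorial)) *
    (√(1 - t ^ 2) ^ m * (Polynomial.derivative^[m] (legendrePoly n)).eval t)

/-- The fully normalized real surface spherical harmonic of degree `n` and order `m`, `|m| ≤ n`,
as a function of the colatitude `θ` and the longitude `φ`; its square has mean one over the unit
sphere. -/
def sphHarm (n : ℕ) (m : ℤ) (θ φ : ℝ) : ℝ :=
  assocLegendre n m.natAbs (Real.cos θ) *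
    (if 0 ≤ m then Real.cos (m.natAbs * φ) else Real.sin (m.natAbs * φ))

/-- Colatitude of a point. -/
def colatitude (x : E3) : ℝ := Real.arccos (x 2 / ‖x‖)

/-- Longitude of a point. -/
def longitude (x : E3) : ℝ := Complex.arg ⟨x 0, x 1⟩

/-- The coefficient `C_{n,m}` of the spherical harmonic expansion of the gravitational potential
`V_f(x) = G ∫ f(y) / ‖x - y‖ dy`, in terms of the density:
`C_{n,m} = 1 / ((2n+1) M) ∫ (‖y‖ / R)^n Y_{n,m}(y) f(y) dy`. -/
def sheCoeff (f : E3 → ℝ) (n : ℕ) (m : ℤ) : ℝ :=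
  1 / ((2 * n + 1) * totalMass f) *
    ∫ y, (‖y‖ / brillouinRadius f) ^ n * sphHarm n m (colatitude y) (longitude y) * f y

/-- The truncation at degree `N` of the spherical harmonic expansion of the potential of `f`
about infinity; `G` is the gravitational constant. -/
def sheTrunc (G : ℝ) (f : E3 → ℝ) (N : ℕ) (x : E3) : ℝ :=
  G * totalMass f / brillouinRadius f *
    ∑ n ∈ Finset.range (N + 1), ∑ m ∈ Finset.Icc (-(n : ℤ)) n,
      (brillouinRadius f / ‖x‖) ^ (n + 1) * sheCoeff f n m *
        sphHarm n m (colatitude x) (longitude x)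

/-- The spherical harmonic expansion of the potential of `f` converges uniformly on `s`. -/
def SHEConvergesUniformlyOn (G : ℝ) (f : E3 → ℝ) (s : Set E3) : Prop :=
  ∃ V : E3 → ℝ, TendstoUniformlyOn (sheTrunc G f) V atTop s

/-- The radius `R_c(f)`: the infimum of the `r > 0` such that the expansion converges uniformly
outside the closed ball of radius `r` about the origin. -/
def convRadius (G : ℝ) (f : Density) : ℝ :=
  sInf {r : ℝ | 0 < r ∧ SHEConvergesUniformlyOn G f.1 (Metric.closedBall (0 : E3) r)ᶜ}

/-- The densities with the `ε`-descent property: the expansion converges uniformly on the part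
`‖x‖ > R(f) - ε` of the free space between the topography and the Brillouin sphere. -/
def descentSet (G ε : ℝ) : Set Density :=
  {f | SHEConvergesUniformlyOn G f.1
    {x | x ∈ freeSpace (tsupport f.1) ∧
      brillouinRadius f.1 - ε < ‖x‖ ∧ ‖x‖ < brillouinRadius f.1}}

/-- The `ε`-descent property expressed through `R_c`: the densities with
`R_c(f) ≤ R(f) - ε`. -/
def radialDescentSet (G ε : ℝ) : Set Density :=
  {f | convRadius G f ≤ brillouinRadius f.1 - ε}

end

/-! ### Legendre functions -/

/-! Arbitrarily close to any density `f` there is a density `g` in both special sets whose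
convergence radius exceeds that of `f` by at least 1. This excludes continuity at every point of
either set.

With `c` the convergence radius of `f`, put `g = f + η * h`, where `h` is the sum of two fixed
densities and `η > 0` is small. One summand is a radial cone on a huge ball. It contributes only to
degree 0 (`multipoleTerm_coneDensity`), so it does not affect convergence, but it turns the support
into a ball whose Brillouin radius exceeds by more than `ε` a radius outside which the expansion of
`f` plus the other summand converges. A crude estimate (`tendstoUniformlyOn_multipole`) supplies
that radius. Both descent properties then hold, however small `η` is.

The other summand lives on the upper half ball of radius `c + 2`. Its terms do not tend to 0 on the
polar axis below `c + 2` (`not_tendsto_multipoleTerm_halfBallDensity`), because the kink of `max t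
0` at the equator leaves Legendre coefficients that decay only polynomially
(`le_abs_integral_mul_legendrePoly`). The terms of `f` do tend to 0 beyond `c`, so those of `g`
cannot on the axis between `c` and `c + 2`. Since `h` does not depend on `η`, the weighted distance
from `f` to `g` is `η` times a constant (`exists_near_of_perturbation`). -/

theorem eval_iterate_derivative_sq_sub_one_pow_eq_zero {n k : ℕ} (hk : k < n) {t : ℝ}
    (ht : t ^ 2 = 1) :
    (Polynomial.derivative^[k] ((Polynomial.X ^ 2 - 1 : Polynomial ℝ) ^ n)).eval t = 0 := by
  obtain ⟨q, hq⟩ :=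
    Polynomial.pow_sub_dvd_iterate_derivative_pow (Polynomial.X ^ 2 - 1 : Polynomial ℝ) n k
  rw [hq]
  simp [ht, Nat.sub_ne_zero_of_lt hk]

theorem integral_eval_derivative (F : Polynomial ℝ) (a b : ℝ) :
    ∫ t in a..b, (Polynomial.derivative F).eval t = F.eval b - F.eval a :=
  intervalIntegral.integral_eq_sub_of_hasDerivAt (fun t _ => F.hasDerivAt t)
    ((Polynomial.derivative F).continuous.intervalIntegrable _ _)

/-- By Rodrigues' formula an antiderivative is a multiple of a derivative of `(X ^ 2 - 1) ^ n` of
order below `n`, which vanishes at both endpoints. -/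
theorem integral_legendrePoly {n : ℕ} (hn : n ≠ 0) :
    ∫ t in (-1 : ℝ)..1, (legendrePoly n).eval t = 0 := by
  obtain ⟨k, rfl⟩ := Nat.exists_eq_succ_of_ne_zero hn
  simp only [legendrePoly, Polynomial.eval_mul, Polynomial.eval_C,
    intervalIntegral.integral_const_mul, Function.iterate_succ_apply', integral_eval_derivative]
  rw [eval_iterate_derivative_sq_sub_one_pow_eq_zero (by simp) (by norm_num),
    eval_iterate_derivative_sq_sub_one_pow_eq_zero (by simp) (by norm_num)]
  simp

theorem eval_zero_iterate_derivative_sq_sub_one_pow (n j : ℕ) :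
    (Polynomial.derivative^[2 * j] ((Polynomial.X ^ 2 - 1 : Polynomial ℝ) ^ n)).eval 0
      = (2 * j).factorial * ((-1) ^ (n - j) * n.choose j) := by
  have h : (Polynomial.X ^ 2 - 1 : Polynomial ℝ) ^ n
      = Polynomial.expand ℝ 2 ((Polynomial.X + Polynomial.C (-1)) ^ n) := by
    simp [sub_eq_add_neg]
  rw [← Polynomial.coeff_zero_eq_eval_zero, Polynomial.coeff_iterate_derivative, h,
    Polynomial.coeff_expand (by norm_num), zero_add, if_pos (by simp),
    Nat.mul_div_cancel_left _ (by norm_num), Polynomial.coeff_X_add_C_pow, Nat.descFactorial_self,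
    nsmul_eq_mul]

/-- Integration by parts: with `n = 2 * j + 2` and `W = (X ^ 2 - 1) ^ n`, the polynomial `t W⁽ⁿ⁻¹⁾ -
W⁽ⁿ⁻²⁾` is an antiderivative of `t W⁽ⁿ⁾`. It vanishes at 1, and at 0 only the second summand
survives. -/
theorem integral_mul_legendrePoly (j : ℕ) :
    ∫ t in (0 : ℝ)..1, t * (legendrePoly (2 * j + 2)).eval t
      = 1 / (2 ^ (2 * j + 2) * ((2 * j + 2).factorial : ℝ)) *
        ((2 * j).factorial * ((-1) ^ (2 * j + 2 - j) * (2 * j + 2).choose j)) := by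
  set W : Polynomial ℝ := (Polynomial.X ^ 2 - 1) ^ (2 * j + 2) with hW
  have hd : Polynomial.derivative (Polynomial.X * Polynomial.derivative^[2 * j + 1] W
      - Polynomial.derivative^[2 * j] W) = Polynomial.X * Polynomial.derivative^[2 * j + 2] W := by
    simp [Function.iterate_succ_apply', Polynomial.derivative_mul]
  have h := integral_eval_derivative (Polynomial.X * Polynomial.derivative^[2 * j + 1] W
      - Polynomial.derivative^[2 * j] W) 0 1
  rw [hd] at h
  simp only [Polynomial.eval_mul, Polynomial.eval_X, Polynomial.eval_sub] at h
  rw [eval_iterate_derivative_sq_sub_one_pow_eq_zero (by omega) (by norm_num),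
    eval_iterate_derivative_sq_sub_one_pow_eq_zero (by omega) (by norm_num),
    eval_zero_iterate_derivative_sq_sub_one_pow] at h
  have h2 : ∀ t : ℝ, t * (legendrePoly (2 * j + 2)).eval t
      = 1 / (2 ^ (2 * j + 2) * ((2 * j + 2).factorial : ℝ)) *
        (t * (Polynomial.derivative^[2 * j + 2] W).eval t) := by
    intro t
    simp only [legendrePoly, Polynomial.eval_mul, Polynomial.eval_C, ← hW]
    ring
  simp only [h2, intervalIntegral.integral_const_mul, h]
  ring

/-- The even Legendre coefficients of `max t 0` do not decay exponentially. -/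
theorem le_abs_integral_mul_legendrePoly (j : ℕ) :
    1 / (2 * (2 * j + 2 : ℝ) ^ 3) ≤ |∫ t in (0 : ℝ)..1, t * (legendrePoly (2 * j + 2)).eval t| := by
  rw [integral_mul_legendrePoly]
  -- The standard lower bound for the central binomial coefficient, moved to its neighbour at the
  -- cost of the ratio `(j + 2) / (j + 1) ≤ 2`.
  have hc : (4 : ℝ) ^ (j + 1) ≤ 4 * (j + 1) * (2 * j + 2).choose j := by
    have h1 : (2 * j + 2).choose (j + 1) * (j + 1) = (2 * j + 2).choose j * (j + 2) := by
      have := Nat.choose_succ_right_eq (2 * j + 2) j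
      rwa [show 2 * j + 2 - j = j + 2 by omega] at this
    have h2 := Nat.four_pow_le_two_mul_self_mul_centralBinom (j + 1) (by omega)
    rw [Nat.centralBinom, show 2 * (j + 1) = 2 * j + 2 by ring] at h2
    have h3 : (2 * j + 2) * (2 * j + 2).choose (j + 1) ≤ 4 * (j + 1) * (2 * j + 2).choose j := by
      nlinarith [Nat.zero_le ((2 * j + 2).choose j * j)]
    exact_mod_cast h2.trans h3
  have hf : ((2 * j + 2).factorial : ℝ) = (2 * j + 2) * (2 * j + 1) * (2 * j).factorial := by
    rw [Nat.factorial_succ, Nat.factorial_succ]; push_cast; ring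
  have h0 : (0 : ℝ) < (2 * j).factorial := by positivity
  simp only [abs_neg, abs_mul, abs_one, abs_pow, one_pow, one_mul]
  rw [abs_of_nonneg (by positivity), Nat.abs_cast, Nat.abs_cast, hf,
    show (2 : ℝ) ^ (2 * j + 2) = 4 ^ (j + 1) by
      rw [show 2 * j + 2 = 2 * (j + 1) by ring, pow_mul]; norm_num]
  have h4 : 1 / (4 ^ (j + 1) * ((2 * j + 2) * (2 * j + 1) * ((2 * j).factorial : ℝ))) *
      (((2 * j).factorial : ℝ) * ((2 * j + 2).choose j : ℝ))
      = ((2 * j + 2).choose j : ℝ) / (4 ^ (j + 1) * ((2 * j + 2) * (2 * j + 1))) := by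
    field_simp
  rw [h4, div_le_div_iff₀ (by positivity) (by positivity), one_mul]
  calc (4 : ℝ) ^ (j + 1) * ((2 * j + 2) * (2 * j + 1))
      ≤ 4 * (j + 1) * (2 * j + 2).choose j * ((2 * j + 2) * (2 * j + 2)) := by
        gcongr
        norm_num
    _ = (2 * j + 2).choose j * (2 * (2 * j + 2 : ℝ) ^ 3) := by ring

/-- Leibniz' rule for `(X - 1) ^ n * (X + 1) ^ n`: at 1 only the summand with all `n` derivatives on
the first factor survives, and it equals `n! * 2 ^ n`. -/
theorem eval_one_legendrePoly (n : ℕ) : (legendrePoly n).eval 1 = 1 := by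
  have h : Polynomial.derivative^[n] ((Polynomial.X ^ 2 - 1 : Polynomial ℝ) ^ n)
      = ∑ k ∈ Finset.range n.succ, n.choose k • (Polynomial.derivative^[n - k]
        ((Polynomial.X - Polynomial.C 1 : Polynomial ℝ) ^ n) *
        Polynomial.derivative^[k] ((Polynomial.X + Polynomial.C 1 : Polynomial ℝ) ^ n)) := by
    rw [← Polynomial.iterate_derivative_mul, ← mul_pow]
    congr 2
    simp only [map_one]
    ring
  simp only [legendrePoly, Polynomial.eval_mul, Polynomial.eval_C, h, Polynomial.eval_finsetSum]
  rw [Finset.sum_eq_single 0]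
  · simp only [Polynomial.iterate_derivative_X_sub_pow, tsub_zero]
    simp [Nat.descFactorial_self]
    norm_num
    field_simp
  · intro k hk hk0
    have : n - (n - k) ≠ 0 := by simp at hk; omega
    rw [Polynomial.iterate_derivative_X_sub_pow]
    simp [this]
  · simp

/-! ### Exponential bounds and measurability of the spherical harmonics -/

theorem abs_eval_iterate_derivative_sq_sub_one_pow_le (n j : ℕ) {t : ℝ} (ht : |t| ≤ 1) :
    |(Polynomial.derivative^[j] ((Polynomial.X ^ 2 - 1 : Polynomial ℝ) ^ n)).eval t|
      ≤ 2 ^ n * (2 * n).descFactorial j := by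
  -- Each monomial is differentiated separately; the signs are discarded and the binomial
  -- coefficients add up to `2 ^ n`.
  have h : (Polynomial.X ^ 2 - 1 : Polynomial ℝ) ^ n = ∑ k ∈ Finset.range (n + 1),
      Polynomial.C ((-1 : ℝ) ^ (n - k) * n.choose k) * Polynomial.X ^ (2 * k) := by
    rw [sub_eq_add_neg, add_pow]
    refine Finset.sum_congr rfl fun k _ => ?_
    rw [← pow_mul]
    simp only [map_mul, map_pow, map_neg, map_one, map_natCast]
    ring
  rw [h, Polynomial.iterate_derivative_sum, Polynomial.eval_finsetSum]
  calc _ ≤ ∑ k ∈ Finset.range (n + 1), (n.choose k : ℝ) * (2 * n).descFactorial j := by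
        refine (Finset.abs_sum_le_sum_abs _ _).trans (Finset.sum_le_sum fun k hk => ?_)
        rw [Polynomial.iterate_derivative_C_mul, Polynomial.iterate_derivative_X_pow_eq_C_mul]
        simp only [Polynomial.eval_mul, Polynomial.eval_C, Polynomial.eval_pow, Polynomial.eval_X,
          abs_mul, abs_pow, abs_neg, abs_one, one_pow, one_mul, Nat.abs_cast]
        gcongr
        have hk' : k ≤ n := by simp at hk; omega
        have h1 : ((2 * k).descFactorial j : ℝ) ≤ (2 * n).descFactorial j := by
          exact_mod_cast Nat.descFactorial_le j (by omega)
        calc ((2 * k).descFactorial j : ℝ) * |t| ^ (2 * k - j)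
            ≤ (2 * n).descFactorial j * 1 := by
              gcongr
              exact pow_le_one₀ (abs_nonneg t) ht
          _ = _ := mul_one _
    _ = 2 ^ n * (2 * n).descFactorial j := by
        rw [← Finset.sum_mul]
        congr 1
        exact_mod_cast Nat.sum_range_choose n

/-- Log-convexity of the factorial: the `m` factors from `n - m` up to `n` are at most `n`, those
from `n` up to `n + m` are larger. -/
theorem factorial_sq_le_mul_factorial {n m : ℕ} (hm : m ≤ n) :
    n.factorial ^ 2 ≤ (n - m).factorial * (n + m).factorial := by
  obtain ⟨k, rfl⟩ := Nat.exists_eq_add_of_le' hm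
  have h1 := Nat.factorial_mul_pow_le_factorial (m := k + m) (n := m)
  have h2 : (k + m).factorial ≤ k.factorial * (k + m) ^ m := by
    have h := Nat.factorial_mul_descFactorial (n := k + m) (k := m) (by omega)
    rw [Nat.add_sub_cancel] at h
    rw [← h]
    gcongr
    exact Nat.descFactorial_le_pow _ _
  rw [Nat.add_sub_cancel]
  calc (k + m).factorial ^ 2 = (k + m).factorial * (k + m).factorial := sq _
    _ ≤ (k.factorial * (k + m) ^ m) * (k + m).factorial := by gcongr
    _ ≤ (k.factorial * (k + m + 1) ^ m) * (k + m).factorial :=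
      Nat.mul_le_mul_right _ (Nat.mul_le_mul_left _ (Nat.pow_le_pow_left (Nat.le_succ _) _))
    _ = k.factorial * ((k + m).factorial * (k + m + 1) ^ m) := by ring
    _ ≤ _ := by gcongr

/-- A crude exponential bound for the normalized associated Legendre functions. -/
theorem abs_assocLegendre_le {n m : ℕ} (hm : m ≤ n) {t : ℝ} (ht : |t| ≤ 1) :
    |assocLegendre n m t| ≤ √(2 * (2 * n + 1)) * 4 ^ n := by
  have hs : |√(1 - t ^ 2) ^ m| ≤ 1 := by
    rw [abs_pow, abs_of_nonneg (Real.sqrt_nonneg _)]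
    refine pow_le_one₀ (Real.sqrt_nonneg _) ?_
    rw [Real.sqrt_le_one]
    nlinarith [sq_nonneg t]
  have hP : |(Polynomial.derivative^[m] (legendrePoly n)).eval t|
      ≤ (2 * n).factorial / (n.factorial * (n - m).factorial) := by
    rw [legendrePoly, Polynomial.iterate_derivative_C_mul, ← Function.iterate_add_apply]
    rw [Polynomial.eval_mul, Polynomial.eval_C, abs_mul, abs_of_nonneg (by positivity)]
    refine (mul_le_mul_of_nonneg_left
      (abs_eval_iterate_derivative_sq_sub_one_pow_le n (m + n) ht) (by positivity)).trans
        (le_of_eq ?_)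
    have h := Nat.factorial_mul_descFactorial (n := 2 * n) (k := m + n) (by omega)
    rw [show 2 * n - (m + n) = n - m by omega] at h
    rw [← h]
    push_cast
    field_simp
  have hc : (2 * n).factorial ≤ 4 ^ n * n.factorial ^ 2 := by
    have h1 := Nat.choose_mul_factorial_mul_factorial (n := 2 * n) (k := n) (by omega)
    rw [show 2 * n - n = n by omega] at h1
    have h2 : (2 * n).choose n ≤ 4 ^ n := by
      have := Nat.choose_le_two_pow (2 * n) n
      rwa [pow_mul] at this
    calc (2 * n).factorial = (2 * n).choose n * n.factorial ^ 2 := by rw [← h1]; ring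
      _ ≤ _ := by gcongr
  -- Chosen so that `(n - m)!` cancels against the denominator in `hP`, leaving the central binomial
  -- coefficient bounded in `hc`.
  have hq : √((n - m).factorial / (n + m).factorial : ℝ) ≤ (n - m).factorial / n.factorial := by
    rw [Real.sqrt_le_left (by positivity), div_pow,
      div_le_div_iff₀ (by positivity) (by positivity)]
    have := factorial_sq_le_mul_factorial hm
    calc ((n - m).factorial : ℝ) * n.factorial ^ 2
        ≤ (n - m).factorial * ((n - m).factorial * (n + m).factorial) := by
          gcongr; exact_mod_cast this
      _ = _ := by ring
  have hif : (if m = 0 then (1 : ℝ) else 2) * (2 * n + 1) ≤ 2 * (2 * n + 1) := by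
    gcongr; split_ifs <;> norm_num
  rw [assocLegendre, abs_mul, abs_mul, abs_of_nonneg (Real.sqrt_nonneg _),
    Real.sqrt_mul (by positivity), mul_assoc]
  calc _ ≤ √(2 * (2 * n + 1)) * (((n - m).factorial / n.factorial) *
        (1 * ((2 * n).factorial / (n.factorial * (n - m).factorial)))) := by
        gcongr
    _ = √(2 * (2 * n + 1)) * ((2 * n).factorial / n.factorial ^ 2) := by field_simp
    _ ≤ _ := by
        gcongr
        rw [div_le_iff₀ (by positivity)]
        exact_mod_cast hc

theorem continuous_assocLegendre (n m : ℕ) : Continuous (assocLegendre n m) := by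
  unfold assocLegendre
  fun_prop

theorem abs_sphHarm_le {n : ℕ} {m : ℤ} (hm : m ∈ Finset.Icc (-(n : ℤ)) n) (θ φ : ℝ) :
    |sphHarm n m θ φ| ≤ √(2 * (2 * n + 1)) * 4 ^ n := by
  have hm' : m.natAbs ≤ n := by simp at hm; omega
  rw [sphHarm, abs_mul]
  refine (mul_le_mul (abs_assocLegendre_le hm' (Real.abs_cos_le_one θ)) (c := |_|) (d := 1) ?_
    (abs_nonneg _) (by positivity)).trans_eq (mul_one _)
  split_ifs
  · exact Real.abs_cos_le_one _
  · exact Real.abs_sin_le_one _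

theorem measurable_colatitude : Measurable colatitude := by
  unfold colatitude
  have : Measurable fun x : E3 => x 2 / ‖x‖ := by fun_prop
  exact Real.continuous_arccos.measurable.comp this

theorem measurable_longitude : Measurable longitude := by
  unfold longitude
  refine Complex.measurable_arg.comp ?_
  have : (fun x : E3 => (⟨x 0, x 1⟩ : ℂ)) = fun x => (x 0 : ℂ) + (x 1 : ℂ) * Complex.I := by
    funext x
    apply Complex.ext <;> simp
  rw [this]
  fun_prop

theorem measurable_sphHarm (n : ℕ) (m : ℤ) :
    Measurable fun x : E3 => sphHarm n m (colatitude x) (longitude x) := by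
  unfold sphHarm
  refine Measurable.mul ?_ ?_
  · exact (continuous_assocLegendre _ _).measurable.comp
      (Real.measurable_cos.comp measurable_colatitude)
  · have := measurable_longitude
    split_ifs <;> fun_prop

noncomputable section

/-! ### The expansion without its normalization -/

/-- The unnormalized multipole moment of degree `n` and order `m`. -/
def multipoleMoment (f : E3 → ℝ) (n : ℕ) (m : ℤ) : ℝ :=
  ∫ y, ‖y‖ ^ n * sphHarm n m (colatitude y) (longitude y) * f y

/-- The term of degree `n` of the multipole expansion about infinity. -/
def multipoleTerm (f : E3 → ℝ) (n : ℕ) (x : E3) : ℝ :=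
  ∑ m ∈ Finset.Icc (-(n : ℤ)) n,
    (1 / ‖x‖) ^ (n + 1) * (1 / (2 * n + 1)) * multipoleMoment f n m *
      sphHarm n m (colatitude x) (longitude x)

end

theorem integrable_multipole {f : E3 → ℝ} (hf : Continuous f) (hfc : HasCompactSupport f)
    {n : ℕ} {m : ℤ} (hm : m ∈ Finset.Icc (-(n : ℤ)) n) :
    Integrable fun y : E3 => ‖y‖ ^ n * sphHarm n m (colatitude y) (longitude y) * f y := by
  have h : Integrable fun y : E3 => ‖y‖ ^ n * f y :=
    (Continuous.mul (by fun_prop) hf).integrable_of_hasCompactSupport hfc.mul_left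
  refine (h.bdd_mul (measurable_sphHarm n m).aestronglyMeasurable
    (Eventually.of_forall fun y => abs_sphHarm_le hm _ _)).congr
    (Eventually.of_forall fun y => ?_)
  simp only
  ring

theorem multipoleTerm_add {f g : E3 → ℝ} (hf : Continuous f) (hfc : HasCompactSupport f)
    (hg : Continuous g) (hgc : HasCompactSupport g) (n : ℕ) (x : E3) :
    multipoleTerm (fun y => f y + g y) n x = multipoleTerm f n x + multipoleTerm g n x := by
  rw [multipoleTerm, multipoleTerm, multipoleTerm, ← Finset.sum_add_distrib]
  refine Finset.sum_congr rfl fun m hm => ?_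
  have h : multipoleMoment (fun y => f y + g y) n m
      = multipoleMoment f n m + multipoleMoment g n m := by
    simp only [multipoleMoment, mul_add]
    exact integral_add (integrable_multipole hf hfc hm) (integrable_multipole hg hgc hm)
  rw [h]
  ring

theorem multipoleTerm_const_mul (c : ℝ) (f : E3 → ℝ) (n : ℕ) (x : E3) :
    multipoleTerm (fun y => c * f y) n x = c * multipoleTerm f n x := by
  rw [multipoleTerm, multipoleTerm, Finset.mul_sum]
  refine Finset.sum_congr rfl fun m hm => ?_
  have h : multipoleMoment (fun y => c * f y) n m = c * multipoleMoment f n m := by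
    simp only [multipoleMoment, ← integral_const_mul]
    congr 1
    funext y
    ring
  rw [h]
  ring

/-- The mass and all powers of the Brillouin radius cancel, so the terms become linear in the
density, even though both normalizations change under perturbation. -/
theorem sheTrunc_eq {G : ℝ} {f : E3 → ℝ} (hR : brillouinRadius f ≠ 0) (hM : totalMass f ≠ 0)
    (N : ℕ) (x : E3) :
    sheTrunc G f N x = ∑ n ∈ Finset.range (N + 1), G * multipoleTerm f n x := by
  rw [sheTrunc, Finset.mul_sum]
  refine Finset.sum_congr rfl fun n _ => ?_
  rw [multipoleTerm, Finset.mul_sum, Finset.mul_sum]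
  refine Finset.sum_congr rfl fun m _ => ?_
  have h : ∫ y, (‖y‖ / brillouinRadius f) ^ n * sphHarm n m (colatitude y) (longitude y) * f y
      = (1 / brillouinRadius f) ^ n * multipoleMoment f n m := by
    rw [multipoleMoment, ← integral_const_mul]
    congr 1
    funext y
    ring
  rw [sheCoeff, h, div_eq_mul_one_div (brillouinRadius f) ‖x‖, mul_pow, one_div_pow (brillouinRadius f)]
  generalize 1 / ‖x‖ = s
  field_simp
  ring

/-! ### Size of the multipole terms and a crude convergence region -/

theorem abs_multipoleMoment_le {f : E3 → ℝ} (hf : Continuous f) (hfc : HasCompactSupport f)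
    {ρ : ℝ} (hfρ : ∀ y, f y ≠ 0 → ‖y‖ ≤ ρ) {n : ℕ} {m : ℤ}
    (hm : m ∈ Finset.Icc (-(n : ℤ)) n) :
    |multipoleMoment f n m| ≤ ρ ^ n * (√(2 * (2 * n + 1)) * 4 ^ n) * ∫ y, |f y| := by
  rw [multipoleMoment, ← integral_const_mul]
  refine abs_integral_le_integral_abs.trans (integral_mono (integrable_multipole hf hfc hm).abs
    ((hf.integrable_of_hasCompactSupport hfc).abs.const_mul _) fun y => ?_)
  by_cases hy : f y = 0
  · simp [hy]
  · simp only [abs_mul, abs_pow, abs_norm]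
    have h0 := hfρ y hy
    have h1 := abs_sphHarm_le hm (colatitude y) (longitude y)
    gcongr
    exact pow_nonneg ((norm_nonneg y).trans h0) n

/-- The 16 is `4 * 4`: the bound for a spherical harmonic enters once through the moment and once
through the evaluation at `x`. The number `2 * n + 1` of orders cancels the prefactor; the two
square roots bring it back. -/
theorem abs_multipoleTerm_le {f : E3 → ℝ} (hf : Continuous f) (hfc : HasCompactSupport f)
    {ρ : ℝ} (hρ : 0 ≤ ρ) (hfρ : ∀ y, f y ≠ 0 → ‖y‖ ≤ ρ) (n : ℕ) {r : ℝ} (hr : 0 < r) {x : E3}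
    (hx : r < ‖x‖) :
    |multipoleTerm f n x| ≤ 2 * (1 / r) * (∫ y, |f y|) * ((2 * n + 1) * (16 * ρ / r) ^ n) := by
  have hI : 0 ≤ ∫ y, |f y| := integral_nonneg fun y => abs_nonneg _
  calc |multipoleTerm f n x| ≤ ∑ m ∈ Finset.Icc (-(n : ℤ)) n, (1 / r) ^ (n + 1) * (1 / (2 * n + 1)) *
        (ρ ^ n * (√(2 * (2 * n + 1)) * 4 ^ n) * ∫ y, |f y|) * (√(2 * (2 * n + 1)) * 4 ^ n) := by
        refine (Finset.abs_sum_le_sum_abs _ _).trans (Finset.sum_le_sum fun m hm => ?_)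
        rw [abs_mul, abs_mul, abs_of_nonneg (by positivity)]
        have h1 := abs_sphHarm_le hm (colatitude x) (longitude x)
        have h2 := abs_multipoleMoment_le hf hfc hfρ hm
        gcongr
    _ = _ := by
        rw [Finset.sum_const, Int.card_Icc, nsmul_eq_mul,
          show ((n : ℤ) + 1 - -(n : ℤ)).toNat = 2 * n + 1 by omega]
        have hs : √(2 * (2 * n + 1) : ℝ) * √(2 * (2 * n + 1)) = 2 * (2 * n + 1) :=
          Real.mul_self_sqrt (by positivity)
        have h4 : (4 : ℝ) ^ n * 4 ^ n = 16 ^ n := by rw [← mul_pow]; norm_num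
        calc _ = ((2 * n + 1 : ℕ) : ℝ) * ((1 / r) ^ (n + 1) * (1 / (2 * n + 1)) *
              (ρ ^ n * ∫ y, |f y|)) * (√(2 * (2 * n + 1) : ℝ) * √(2 * (2 * n + 1))) *
              ((4 : ℝ) ^ n * 4 ^ n) := by ring
          _ = _ := by
            rw [hs, h4, div_pow (16 * ρ), mul_pow 16 ρ, one_div_pow, pow_succ]
            push_cast
            field_simp

/-- A crude convergence region of the multipole expansion. -/
theorem tendstoUniformlyOn_multipole {f : E3 → ℝ} (hf : Continuous f) (hfc : HasCompactSupport f)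
    {ρ : ℝ} (hρ : 0 ≤ ρ) (hfρ : ∀ y, f y ≠ 0 → ‖y‖ ≤ ρ) {r : ℝ} (hr : 0 < r)
    (hρr : 16 * ρ < r) :
    TendstoUniformlyOn (fun N x => ∑ n ∈ Finset.range (N + 1), multipoleTerm f n x)
      (fun x => ∑' n, multipoleTerm f n x) atTop (Metric.closedBall (0 : E3) r)ᶜ := by
  have hq : ‖16 * ρ / r‖ < 1 := by
    rw [Real.norm_of_nonneg (by positivity), div_lt_one hr]
    exact hρr
  have hs : Summable fun n : ℕ => (2 * n + 1) * (16 * ρ / r) ^ n := by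
    have h1 := (summable_pow_mul_geometric_of_norm_lt_one 1 hq).mul_left 2
    have h0 := summable_pow_mul_geometric_of_norm_lt_one 0 hq
    refine (h1.add h0).congr fun n => ?_
    ring
  have h := tendstoUniformlyOn_tsum_nat (s := (Metric.closedBall (0 : E3) r)ᶜ)
    (hs.mul_left (2 * (1 / r) * (∫ y, |f y|)))
    (f := fun n x => multipoleTerm f n x) fun n x hx => by
      refine abs_multipoleTerm_le hf hfc hρ hfρ n hr ?_
      simpa using hx
  exact fun v hv => (tendsto_add_atTop_nat 1).eventually (h v hv)

/-! ### Integration in spherical coordinates -/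

/-- Splitting off the last coordinate preserves the volume. -/
theorem integral_comp_coordinates (F : ℝ × ℝ × ℝ → ℝ) :
    ∫ y : E3, F (y 2, y 0, y 1) = ∫ q, F q := by
  have h1 := EuclideanSpace.volume_preserving_symm_measurableEquiv_toLp (Fin 3)
  have h2 := volume_preserving_piFinSuccAbove (fun _ : Fin 3 => ℝ) 2
  have h3 := (MeasurePreserving.id (volume : Measure ℝ)).prod (volume_preserving_finTwoArrow ℝ)
  have e1 := h1.integral_comp' (fun y => F (y 2, y 0, y 1))
  have e2 := h2.integral_comp' (fun q : ℝ × (Fin 2 → ℝ) => F (q.1, q.2 0, q.2 1))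
  have e3 := h3.integral_comp (MeasurableEquiv.prodCongr (MeasurableEquiv.refl ℝ)
    (MeasurableEquiv.finTwoArrow (α := ℝ))).measurableEmbedding F
  refine e1.trans (e2.trans ?_)
  exact e3

theorem integrable_comp_coordinates {F : ℝ × ℝ × ℝ → ℝ}
    (hF : Integrable fun y : E3 => F (y 2, y 0, y 1)) : Integrable F := by
  have h1 := EuclideanSpace.volume_preserving_symm_measurableEquiv_toLp (Fin 3)
  have h2 := volume_preserving_piFinSuccAbove (fun _ : Fin 3 => ℝ) 2
  have h3 := (MeasurePreserving.id (volume : Measure ℝ)).prod (volume_preserving_finTwoArrow ℝ)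
  have e3 := h3.integrable_comp_emb (MeasurableEquiv.prodCongr (MeasurableEquiv.refl ℝ)
    (MeasurableEquiv.finTwoArrow (α := ℝ))).measurableEmbedding (g := F)
  refine e3.1 ?_
  refine (h2.integrable_comp_emb (MeasurableEquiv.measurableEmbedding _)).1 ?_
  exact (h1.integrable_comp_emb (MeasurableEquiv.measurableEmbedding _)).1 hF

theorem norm_eq_sqrt_coordinates (y : E3) : ‖y‖ = √(y 2 ^ 2 + (y 0 ^ 2 + y 1 ^ 2)) := by
  rw [EuclideanSpace.norm_eq, Fin.sum_univ_three]
  simp only [Real.norm_eq_abs, sq_abs]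
  congr 1
  ring

theorem exists_bound_comp_cos {v : ℝ → ℝ} (hv : Continuous v) : ∃ C, ∀ t, |v (Real.cos t)| ≤ C := by
  obtain ⟨C, hC⟩ := (isCompact_Icc (a := (-1 : ℝ)) (b := 1)).exists_bound_of_continuousOn
    hv.continuousOn
  exact ⟨C, fun t => hC _ (Real.cos_mem_Icc t)⟩

/-- Here `z` is the height and `s` the distance from the polar axis. In polar coordinates of the
half plane the angle is the colatitude, and `s` supplies the `sin` that the substitution `t = cos θ`
absorbs. -/
theorem integral_half_plane {u v : ℝ → ℝ} (hu : Continuous u) (hv : Continuous v) {R : ℝ}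
    (huR : ∀ r, R < r → u r = 0) :
    ∫ z : ℝ, ∫ s in Ioi (0 : ℝ), s * (u √(z ^ 2 + s ^ 2) *
        v (Real.cos (Real.arccos (z / √(z ^ 2 + s ^ 2)))))
      = (∫ r in Ioi (0 : ℝ), r ^ 2 * u r) * ∫ t in (-1 : ℝ)..1, v t := by
  obtain ⟨C, hC⟩ := exists_bound_comp_cos hv
  -- Extension by zero to the whole plane makes polar coordinates applicable; the indicator then
  -- confines the angle to `(0, π)`.
  set B : ℝ × ℝ → ℝ := fun q => (Ioi (0 : ℝ)).indicator (fun s => s * (u √(q.1 ^ 2 + s ^ 2) *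
        v (Real.cos (Real.arccos (q.1 / √(q.1 ^ 2 + s ^ 2)))))) q.2 with hB
  have hBi : Integrable B := by
    have h1 : Integrable fun q : ℝ × ℝ => q.2 * u √(q.1 ^ 2 + q.2 ^ 2) := by
      refine Continuous.integrable_of_hasCompactSupport (by fun_prop) ?_
      refine HasCompactSupport.intro (isCompact_closedBall (0 : ℝ × ℝ) R) fun q hq => ?_
      rw [huR, mul_zero]
      rw [mem_closedBall_zero_iff, not_le] at hq
      refine hq.trans_le (max_le ?_ ?_) <;> refine Real.le_sqrt_of_sq_le ?_ <;>
        simp only [Real.norm_eq_abs, sq_abs] <;> nlinarith [sq_nonneg q.1, sq_nonneg q.2]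
    have hm : Measurable fun q : ℝ × ℝ => v (Real.cos (Real.arccos (q.1 / √(q.1 ^ 2 + q.2 ^ 2)))) := by
      refine (hv.comp (Real.continuous_cos.comp Real.continuous_arccos)).measurable.comp ?_
      fun_prop
    have h2 := (h1.bdd_mul hm.aestronglyMeasurable (Eventually.of_forall fun q => hC _)).indicator
      (measurableSet_lt measurable_const measurable_snd : MeasurableSet {q : ℝ × ℝ | 0 < q.2})
    refine h2.congr (Eventually.of_forall fun q => ?_)
    simp only [hB, indicator, mem_Ioi, mem_ofPred_eq]
    split_ifs
    · ring
    · rfl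
  have hI : ∫ z : ℝ, ∫ s in Ioi (0 : ℝ), s * (u √(z ^ 2 + s ^ 2) *
        v (Real.cos (Real.arccos (z / √(z ^ 2 + s ^ 2))))) = ∫ q, B q := by
    rw [Measure.volume_eq_prod, integral_prod _ hBi]
    refine integral_congr_ae (Eventually.of_forall fun z => ?_)
    simp only [hB]
    rw [integral_indicator measurableSet_Ioi]
  rw [hI, ← integral_comp_polarCoord_symm]
  have hpt : ∀ q ∈ polarCoord.target, q.1 • B (polarCoord.symm q)
      = (q.1 ^ 2 * u q.1) * (Ioi (0 : ℝ)).indicator (fun t => Real.sin t * v (Real.cos t)) q.2 := by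
    rintro ⟨r, t⟩ ⟨hr, ht⟩
    simp only [mem_Ioi] at hr
    have hn : √((r * Real.cos t) ^ 2 + (r * Real.sin t) ^ 2) = r := by
      rw [show (r * Real.cos t) ^ 2 + (r * Real.sin t) ^ 2
        = r ^ 2 * (Real.sin t ^ 2 + Real.cos t ^ 2) by ring, Real.sin_sq_add_cos_sq, mul_one,
        Real.sqrt_sq hr.le]
    simp only [polarCoord_symm_apply, hB, smul_eq_mul]
    by_cases ht0 : 0 < t
    · rw [indicator_of_mem (mem_Ioi.2 (mul_pos hr (Real.sin_pos_of_pos_of_lt_pi ht0 ht.2))),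
        indicator_of_mem (mem_Ioi.2 ht0), hn, mul_div_cancel_left₀ _ hr.ne',
        Real.arccos_cos ht0.le ht.2.le]
      ring
    · rw [indicator_of_notMem, indicator_of_notMem (by simpa using ht0)]
      · simp
      · rw [mem_Ioi, not_lt]
        exact mul_nonpos_of_nonneg_of_nonpos hr.le
          (Real.sin_nonpos_of_nonpos_of_neg_pi_le (not_lt.1 ht0) ht.1.le)
  rw [setIntegral_congr_fun polarCoord.open_target.measurableSet hpt]
  have ht : ∫ t in Ioo (-Real.pi) Real.pi,
      (Ioi (0 : ℝ)).indicator (fun t => Real.sin t * v (Real.cos t)) t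
      = ∫ t in (-1 : ℝ)..1, v t := by
    rw [setIntegral_indicator measurableSet_Ioi,
      show Ioo (-Real.pi) Real.pi ∩ Ioi 0 = Ioo 0 Real.pi by
        ext t
        simp only [mem_inter_iff, mem_Ioo, mem_Ioi]
        have := Real.pi_pos
        constructor
        · rintro ⟨⟨_, h⟩, h'⟩; exact ⟨h', h⟩
        · rintro ⟨h', h⟩; exact ⟨⟨by linarith, h⟩, h'⟩,
      ← integral_Ioc_eq_integral_Ioo, ← intervalIntegral.integral_of_le Real.pi_pos.le]
    have h := intervalIntegral.integral_comp_mul_deriv (a := 0) (b := Real.pi) (f := Real.cos)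
      (f' := fun t => -Real.sin t) (g := v) (fun t _ => Real.hasDerivAt_cos t)
      (by fun_prop) hv
    simp only [Function.comp, Real.cos_zero, Real.cos_pi] at h
    rw [intervalIntegral.integral_symm 1 (-1), ← h, ← intervalIntegral.integral_neg]
    congr 1
    funext t
    ring
  rw [← ht, Measure.volume_eq_prod]
  exact setIntegral_prod_mul (fun r : ℝ => r ^ 2 * u r)
    ((Ioi (0 : ℝ)).indicator fun t => Real.sin t * v (Real.cos t)) (Ioi 0)
      (Ioo (-Real.pi) Real.pi)

/-- Integration in spherical coordinates of a product. -/
theorem integral_spherical {u v w : ℝ → ℝ} (hu : Continuous u) (hv : Continuous v)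
    (hw : Continuous w) {R : ℝ} (huR : ∀ r, R < r → u r = 0) :
    ∫ y : E3, u ‖y‖ * v (Real.cos (colatitude y)) * w (longitude y)
      = (∫ r in Ioi (0 : ℝ), r ^ 2 * u r) * (∫ t in (-1 : ℝ)..1, v t) *
        ∫ φ in Ioo (-Real.pi) Real.pi, w φ := by
  obtain ⟨C, hC⟩ := exists_bound_comp_cos hv
  obtain ⟨D, hD⟩ := (isCompact_Icc (a := -Real.pi) (b := Real.pi)).exists_bound_of_continuousOn
    hw.continuousOn
  set F : ℝ × ℝ × ℝ → ℝ := fun q => u √(q.1 ^ 2 + (q.2.1 ^ 2 + q.2.2 ^ 2)) *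
    v (Real.cos (Real.arccos (q.1 / √(q.1 ^ 2 + (q.2.1 ^ 2 + q.2.2 ^ 2))))) *
      w (Complex.arg ⟨q.2.1, q.2.2⟩) with hF
  have hFy : ∀ y : E3, F (y 2, y 0, y 1)
      = u ‖y‖ * v (Real.cos (colatitude y)) * w (longitude y) := fun y => by
    simp only [hF, colatitude, longitude, norm_eq_sqrt_coordinates y]
  have hFi : Integrable F := by
    refine integrable_comp_coordinates ?_
    simp only [hFy]
    have h1 : Integrable fun y : E3 => u ‖y‖ := by
      refine Continuous.integrable_of_hasCompactSupport (by fun_prop) ?_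
      refine HasCompactSupport.intro (isCompact_closedBall (0 : E3) R) fun y hy => huR _ ?_
      simpa using hy
    refine (h1.mul_bdd (c := C) ?_ (Eventually.of_forall fun y => hC _)).mul_bdd (c := D) ?_
      (Eventually.of_forall fun y => hD _ ⟨(Complex.neg_pi_lt_arg _).le, Complex.arg_le_pi _⟩)
    · exact ((hv.comp Real.continuous_cos).measurable.comp
        measurable_colatitude).aestronglyMeasurable
    · exact (hw.measurable.comp measurable_longitude).aestronglyMeasurable
  simp only [← hFy]
  rw [integral_comp_coordinates, Measure.volume_eq_prod, integral_prod _ hFi,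
    ← integral_half_plane hu hv huR, ← integral_mul_const]
  refine integral_congr_ae (Eventually.of_forall fun z => ?_)
  simp only
  -- Polar coordinates in the horizontal plane at height `z`: the angle is the longitude, and the
  -- rest is the half-plane integral.
  rw [← integral_comp_polarCoord_symm]
  have hpt : ∀ q ∈ polarCoord.target, q.1 • F (z, polarCoord.symm q)
      = (q.1 * (u √(z ^ 2 + q.1 ^ 2) * v (Real.cos (Real.arccos (z / √(z ^ 2 + q.1 ^ 2)))))) *
        w q.2 := by
    rintro ⟨s, φ⟩ ⟨hs, hφ⟩
    simp only [mem_Ioi] at hs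
    have hn : (s * Real.cos φ) ^ 2 + (s * Real.sin φ) ^ 2 = s ^ 2 := by
      rw [show (s * Real.cos φ) ^ 2 + (s * Real.sin φ) ^ 2
        = s ^ 2 * (Real.sin φ ^ 2 + Real.cos φ ^ 2) by ring, Real.sin_sq_add_cos_sq, mul_one]
    have ha : Complex.arg ⟨s * Real.cos φ, s * Real.sin φ⟩ = φ := by
      rw [show (⟨s * Real.cos φ, s * Real.sin φ⟩ : ℂ)
        = s * (Complex.cos φ + Complex.sin φ * Complex.I) by
          apply Complex.ext <;> simp [Complex.cos_ofReal_re, Complex.sin_ofReal_re]]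
      exact Complex.arg_mul_cos_add_sin_mul_I hs ⟨hφ.1, hφ.2.le⟩
    simp only [polarCoord_symm_apply, hF, smul_eq_mul, hn, ha]
    ring
  rw [setIntegral_congr_fun polarCoord.open_target.measurableSet hpt, Measure.volume_eq_prod]
  exact setIntegral_prod_mul (fun s : ℝ => s * (u √(z ^ 2 + s ^ 2) *
    v (Real.cos (Real.arccos (z / √(z ^ 2 + s ^ 2)))))) w (Ioi 0) (Ioo (-Real.pi) Real.pi)

noncomputable section

/-! ### Two explicit densities -/

/-- The radially symmetric density on the ball of radius `R` that decreases linearly. -/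
def coneDensity (R : ℝ) (y : E3) : ℝ := max (R - ‖y‖) 0

/-- A density on the upper half ball of radius `R`. -/
def halfBallDensity (R : ℝ) (y : E3) : ℝ := coneDensity R y * max (y 2) 0

/-- The point at height `z` on the polar axis. -/
def axisPoint (z : ℝ) : E3 := EuclideanSpace.single 2 z

end

theorem continuous_coneDensity (R : ℝ) : Continuous (coneDensity R) := by
  unfold coneDensity
  fun_prop

theorem continuous_halfBallDensity (R : ℝ) : Continuous (halfBallDensity R) := by
  have := continuous_coneDensity R
  unfold halfBallDensity
  fun_prop

theorem coneDensity_eq_zero {R : ℝ} {y : E3} (hy : R ≤ ‖y‖) : coneDensity R y = 0 :=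
  max_eq_right (by linarith)

theorem hasCompactSupport_coneDensity (R : ℝ) : HasCompactSupport (coneDensity R) :=
  HasCompactSupport.intro (isCompact_closedBall (0 : E3) R) fun y hy =>
    coneDensity_eq_zero (by simpa using (not_le.1 (by simpa using hy : ¬ ‖y‖ ≤ R)).le)

theorem hasCompactSupport_halfBallDensity (R : ℝ) : HasCompactSupport (halfBallDensity R) :=
  (hasCompactSupport_coneDensity R).mul_right

/-! ### Multipole moments of the two explicit densities -/

theorem integral_longitude_eq_zero {m : ℤ} (hm : m ≠ 0) :
    ∫ φ in Ioo (-Real.pi) Real.pi,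
      (if 0 ≤ m then Real.cos (m.natAbs * φ) else Real.sin (m.natAbs * φ)) = 0 := by
  have hk : (m.natAbs : ℝ) ≠ 0 := by simpa using hm
  rw [← integral_Ioc_eq_integral_Ioo,
    ← intervalIntegral.integral_of_le (by linarith [Real.pi_pos])]
  split_ifs
  · rw [intervalIntegral.integral_comp_mul_left _ hk, integral_cos, mul_neg, Real.sin_neg,
      Real.sin_nat_mul_pi]
    simp
  · rw [intervalIntegral.integral_comp_mul_left _ hk, integral_sin, mul_neg, Real.cos_neg]
    simp

/-- Radially symmetric densities have no multipole moments of positive degree. -/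
theorem multipoleTerm_coneDensity (R : ℝ) {n : ℕ} (hn : n ≠ 0) (x : E3) :
    multipoleTerm (coneDensity R) n x = 0 := by
  refine Finset.sum_eq_zero fun m _ => ?_
  suffices h : multipoleMoment (coneDensity R) n m = 0 by simp [h]
  have h := integral_spherical (u := fun r => r ^ n * max (R - r) 0)
    (v := assocLegendre n m.natAbs)
    (w := fun φ => if 0 ≤ m then Real.cos (m.natAbs * φ) else Real.sin (m.natAbs * φ))
    (by fun_prop) (continuous_assocLegendre _ _) (by split_ifs <;> fun_prop) (R := R)
    (fun r hr => by rw [max_eq_right (by linarith), mul_zero])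
  have h0 : multipoleMoment (coneDensity R) n m = ∫ y : E3, ‖y‖ ^ n * max (R - ‖y‖) 0 *
      assocLegendre n m.natAbs (Real.cos (colatitude y)) *
      (if 0 ≤ m then Real.cos (m.natAbs * longitude y)
        else Real.sin (m.natAbs * longitude y)) := by
    simp only [multipoleMoment, sphHarm, coneDensity]
    congr 1
    funext y
    ring
  rw [h0, h]
  by_cases hm : m = 0
  · have : ∫ t in (-1 : ℝ)..1, assocLegendre n m.natAbs t = 0 := by
      simp only [hm, assocLegendre, Int.natAbs_zero, pow_zero, one_mul, Function.iterate_zero,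
        id, intervalIntegral.integral_const_mul, integral_legendrePoly hn, mul_zero]
    rw [this, mul_zero, zero_mul]
  · rw [integral_longitude_eq_zero hm, mul_zero]

theorem assocLegendre_zero (n : ℕ) (t : ℝ) :
    assocLegendre n 0 t = √(2 * n + 1) * (legendrePoly n).eval t := by
  have : (n.factorial : ℝ) / n.factorial = 1 := div_self (by positivity)
  simp [assocLegendre, this]

theorem norm_axisPoint {z : ℝ} (hz : 0 < z) : ‖axisPoint z‖ = z := by
  simp [axisPoint, abs_of_pos hz]

/-- At the pole the factor `√(1 - t ^ 2) ^ |m|` kills every nonzero order, so one moment per degree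
decides the behaviour on the axis. -/
theorem multipoleTerm_axisPoint (f : E3 → ℝ) (n : ℕ) {z : ℝ} (hz : 0 < z) :
    multipoleTerm f n (axisPoint z)
      = (1 / z) ^ (n + 1) * (1 / (2 * n + 1)) * multipoleMoment f n 0 * √(2 * n + 1) := by
  have hc : Real.cos (colatitude (axisPoint z)) = 1 := by
    have : axisPoint z 2 = z := by simp [axisPoint]
    rw [colatitude, norm_axisPoint hz, this, div_self hz.ne', Real.arccos_one, Real.cos_zero]
  rw [multipoleTerm, Finset.sum_eq_single 0, norm_axisPoint hz]
  · simp [sphHarm, hc, assocLegendre_zero, eval_one_legendrePoly]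
  · intro m _ hm
    simp [sphHarm, hc, assocLegendre, hm]
  · intro h
    simp at h

theorem norm_mul_cos_colatitude (y : E3) : ‖y‖ * Real.cos (colatitude y) = y 2 := by
  have h : |y 2| ≤ ‖y‖ := PiLp.norm_apply_le y 2
  rcases (norm_nonneg y).eq_or_lt with h0 | h0
  · rw [← h0] at h ⊢
    rw [zero_mul, abs_nonpos_iff.1 h]
  · rw [abs_le] at h
    rw [colatitude, Real.cos_arccos, mul_div_cancel₀ _ h0.ne']
    · rw [le_div_iff₀ h0]; linarith
    · rw [div_le_iff₀ h0]; linarith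

theorem integral_radial {R : ℝ} (hR : 0 ≤ R) (n : ℕ) :
    ∫ r in Ioi (0 : ℝ), r ^ 2 * (r ^ (n + 1) * max (R - r) 0)
      = R ^ (n + 5) / ((n + 4) * (n + 5)) := by
  have h1 : ∀ r ∈ Ioi (0 : ℝ), r ^ 2 * (r ^ (n + 1) * max (R - r) 0)
      = (Ioc (0 : ℝ) R).indicator (fun r => R * r ^ (n + 3) - r ^ (n + 4)) r := by
    intro r hr
    by_cases h : r ≤ R
    · rw [indicator_of_mem (show r ∈ Ioc 0 R from ⟨hr, h⟩), max_eq_left (by linarith)]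
      ring
    · rw [indicator_of_notMem (fun h' => h h'.2), max_eq_right (by linarith)]
      ring
  rw [setIntegral_congr_fun measurableSet_Ioi h1, setIntegral_indicator measurableSet_Ioc,
    inter_eq_self_of_subset_right Ioc_subset_Ioi_self, ← intervalIntegral.integral_of_le hR,
    intervalIntegral.integral_sub (Continuous.intervalIntegrable (by fun_prop) _ _)
      (Continuous.intervalIntegrable (by fun_prop) _ _), intervalIntegral.integral_const_mul,
    integral_pow, integral_pow]
  push_cast
  field_simp
  ring

/-- The positive part of the height is `‖y‖ * max (cos θ) 0`, so the integrand is a product in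
spherical coordinates, with one extra power of the radius. -/
theorem multipoleMoment_halfBallDensity {R : ℝ} (hR : 0 ≤ R) (n : ℕ) :
    multipoleMoment (halfBallDensity R) n 0
      = R ^ (n + 5) / ((n + 4) * (n + 5)) *
        (√(2 * n + 1) * ∫ t in (0 : ℝ)..1, t * (legendrePoly n).eval t) * (2 * Real.pi) := by
  have h := integral_spherical (u := fun r => r ^ (n + 1) * max (R - r) 0)
    (v := fun t => √(2 * n + 1) * (max t 0 * (legendrePoly n).eval t)) (w := fun _ => 1)
    (by fun_prop) (by fun_prop) (by fun_prop) (R := R)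
    (fun r hr => by rw [max_eq_right (by linarith), mul_zero])
  have h0 : multipoleMoment (halfBallDensity R) n 0 =
      ∫ y : E3, ‖y‖ ^ (n + 1) * max (R - ‖y‖) 0 * (√(2 * n + 1) *
        (max (Real.cos (colatitude y)) 0 * (legendrePoly n).eval (Real.cos (colatitude y)))) *
          1 := by
    rw [multipoleMoment]
    congr 1
    funext y
    have hy : max (y 2) 0 = ‖y‖ * max (Real.cos (colatitude y)) 0 := by
      rw [mul_max_of_nonneg _ _ (norm_nonneg y), norm_mul_cos_colatitude, mul_zero]
    simp only [halfBallDensity, coneDensity, hy, sphHarm, Int.natAbs_zero, assocLegendre_zero,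
      le_refl, if_true, Nat.cast_zero, zero_mul, Real.cos_zero]
    ring
  have hv : ∫ t in (-1 : ℝ)..1, max t 0 * (legendrePoly n).eval t
      = ∫ t in (0 : ℝ)..1, t * (legendrePoly n).eval t := by
    have hi : ∀ a b : ℝ, IntervalIntegrable (fun t : ℝ => max t 0 * (legendrePoly n).eval t)
        volume a b := fun a b => Continuous.intervalIntegrable (by fun_prop) _ _
    rw [← intervalIntegral.integral_add_adjacent_intervals (hi (-1) 0) (hi 0 1),
      intervalIntegral.integral_congr (a := -1) (b := 0) (g := fun _ => 0),
      intervalIntegral.integral_congr (a := 0) (b := 1)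
        (g := fun t => t * (legendrePoly n).eval t)]
    · simp
    · intro t ht
      rw [uIcc_of_le zero_le_one] at ht
      simp only [max_eq_left ht.1]
    · intro t ht
      rw [uIcc_of_le (by norm_num)] at ht
      simp only [max_eq_right ht.2, zero_mul]
  have hw : ∫ _φ in Ioo (-Real.pi) Real.pi, (1 : ℝ) = 2 * Real.pi := by
    rw [← integral_Ioc_eq_integral_Ioo,
      ← intervalIntegral.integral_of_le (by linarith [Real.pi_pos])]
    simp
    ring
  rw [h0, h, integral_radial hR, intervalIntegral.integral_const_mul, hv, hw]

theorem multipoleTerm_halfBallDensity {R z : ℝ} (hR : 0 ≤ R) (hz : 0 < z) (n : ℕ) :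
    multipoleTerm (halfBallDensity R) n (axisPoint z)
      = (1 / z) ^ (n + 1) * (R ^ (n + 5) / ((n + 4) * (n + 5))) *
        (∫ t in (0 : ℝ)..1, t * (legendrePoly n).eval t) * (2 * Real.pi) := by
  rw [multipoleTerm_axisPoint _ _ hz, multipoleMoment_halfBallDensity hR]
  have hs : √(2 * n + 1 : ℝ) * √(2 * n + 1) = 2 * n + 1 := Real.mul_self_sqrt (by positivity)
  have h1 : (2 * n + 1 : ℝ) ≠ 0 := by positivity
  generalize (∫ t in (0 : ℝ)..1, t * (legendrePoly n).eval t) = c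
  calc _ = (1 / z) ^ (n + 1) * (R ^ (n + 5) / ((n + 4) * (n + 5))) * c * (2 * Real.pi) *
        ((1 / (2 * n + 1)) * (√(2 * n + 1 : ℝ) * √(2 * n + 1))) := by ring
    _ = _ := by rw [hs, one_div_mul_cancel h1, mul_one]

/-- Of the five powers of the degree, two compensate the radial integral and three the Legendre
coefficient. -/
theorem le_abs_multipoleTerm_halfBallDensity {R z : ℝ} (hR : 0 < R) (hz : 0 < z) (j : ℕ) :
    Real.pi * R ^ 5 / (12 * z) ≤ ((2 * j + 2 : ℕ) : ℝ) ^ 5 * (z / R) ^ (2 * j + 2) *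
      |multipoleTerm (halfBallDensity R) (2 * j + 2) (axisPoint z)| := by
  rw [multipoleTerm_halfBallDensity hR.le hz, abs_mul, abs_mul, abs_of_nonneg (by positivity),
    abs_of_pos Real.two_pi_pos]
  have hc := le_abs_integral_mul_legendrePoly j
  have hpi := Real.pi_pos
  have hN : (2 : ℝ) ≤ ((2 * j + 2 : ℕ) : ℝ) := by exact_mod_cast (by omega : 2 ≤ 2 * j + 2)
  rw [show (2 * j + 2 : ℝ) = ((2 * j + 2 : ℕ) : ℝ) by push_cast; ring] at hc
  generalize 2 * j + 2 = N at *
  have hN0 : (0 : ℝ) < N := by linarith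
  -- For `N ≥ 2` one has `N + 4 ≤ 3 * N` and `N + 5 ≤ 4 * N`, whence the 12.
  calc Real.pi * R ^ 5 / (12 * z)
      = (N : ℝ) ^ 5 * (z / R) ^ N * ((1 / z) ^ (N + 1) * (R ^ (N + 5) / ((3 * N) * (4 * N))) *
          (1 / (2 * (N : ℝ) ^ 3)) * (2 * Real.pi)) := by
        rw [div_pow, one_div_pow, pow_succ z, pow_add R]
        field_simp
        norm_num
    _ ≤ _ := by
        gcongr <;> linarith

/-- The expansion for the half ball of radius `R` diverges on the polar axis below `R`. -/
theorem not_tendsto_multipoleTerm_halfBallDensity {R z : ℝ} (hz : 0 < z) (hzR : z < R) :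
    ¬ Tendsto (fun n => multipoleTerm (halfBallDensity R) n (axisPoint z)) atTop (nhds 0) := by
  intro h
  have hR : 0 < R := hz.trans hzR
  have hq : |z / R| < 1 := by
    rw [abs_of_pos (by positivity), div_lt_one hR]
    exact hzR
  have h1 := (tendsto_pow_const_mul_const_pow_of_abs_lt_one 5 hq).mul h.abs
  rw [abs_zero, mul_zero] at h1
  have h2 : Tendsto (fun j : ℕ => 2 * j + 2) atTop atTop :=
    tendsto_atTop_mono (fun j => show j ≤ 2 * j + 2 by omega) tendsto_id
  have h3 := ge_of_tendsto' (h1.comp h2) (b := Real.pi * R ^ 5 / (12 * z)) fun j =>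
    le_abs_multipoleTerm_halfBallDensity hR hz j
  have hpi := Real.pi_pos
  exact absurd h3 (not_le.2 (by positivity))

/-! ### Densities -/

theorem le_of_ball_subset_ball {a b : ℝ} (h : Metric.ball (0 : E3) a ⊆ Metric.ball 0 b)
    (hb : 0 < b) : a ≤ b := by
  refine le_of_forall_lt fun s hs => ?_
  rcases le_or_gt s 0 with h0 | h0
  · exact h0.trans_lt hb
  · have := h (a := axisPoint s) (by rw [mem_ball_zero_iff, norm_axisPoint h0]; exact hs)
    rwa [mem_ball_zero_iff, norm_axisPoint h0] at this

theorem IsDensity.brillouinRadius_pos {f : E3 → ℝ} (hf : IsDensity f) :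
    0 < brillouinRadius f := by
  obtain ⟨δ, hδ, hball⟩ := Metric.mem_nhds_iff.1 (mem_interior_iff_mem_nhds.1 hf.zero_mem)
  refine hδ.trans_le (le_csInf ?_ fun m hm => ?_)
  · obtain ⟨r, hr⟩ := hf.compact_support.isBounded.subset_ball (0 : E3)
    exact ⟨r, hr⟩
  · refine le_of_ball_subset_ball (hball.trans hm) ?_
    simpa using hm (interior_subset hf.zero_mem)

theorem IsDensity.totalMass_pos {f : E3 → ℝ} (hf : IsDensity f) : 0 < totalMass f := by
  refine hf.continuous.integral_pos_of_hasCompactSupport_nonneg_nonzero hf.compact_support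
    hf.nonneg (x := ?_) ?_
  all_goals
    have h : (Function.support f).Nonempty := by
      rw [← closure_nonempty_iff]
      exact ⟨0, interior_subset hf.zero_mem⟩
  · exact h.choose
  · exact h.choose_spec

theorem isClosedSurface_sphere {R : ℝ} (hR : 0 < R) :
    IsClosedSurface (Metric.sphere (0 : E3) R) := by
  refine ⟨isCompact_sphere _ _, isConnected_sphere ?_ _ hR.le, ?_⟩
  · rw [← Module.finrank_eq_rank]
    simp
  · let e : Metric.sphere (0 : E3) R ≃ₜ Metric.sphere (0 : E3) 1 :=
      { toFun := fun x => ⟨R⁻¹ • x.1, by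
          have := x.2
          rw [mem_sphere_zero_iff_norm] at this ⊢
          rw [norm_smul, this, Real.norm_of_nonneg (by positivity), inv_mul_cancel₀ hR.ne']⟩
        invFun := fun x => ⟨R • x.1, by
          have := x.2
          rw [mem_sphere_zero_iff_norm] at this ⊢
          rw [norm_smul, this, Real.norm_of_nonneg hR.le, mul_one]⟩
        left_inv := fun x => Subtype.ext (smul_inv_smul₀ hR.ne' _)
        right_inv := fun x => Subtype.ext (inv_smul_smul₀ hR.ne' _)
        continuous_toFun := by fun_prop
        continuous_invFun := by fun_prop }
    let _ := e.toOpenPartialHomeomorph.singletonChartedSpace rfl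
    exact ⟨ChartedSpace.comp (EuclideanSpace ℝ (Fin 2)) (Metric.sphere (0 : E3) 1) _⟩

theorem tsupport_eq_closedBall {g : E3 → ℝ} {R : ℝ} (hR : 0 < R)
    (hg : Function.support g = Metric.ball (0 : E3) R) :
    tsupport g = Metric.closedBall (0 : E3) R := by
  rw [tsupport, hg, closure_ball _ hR.ne']

/-- Once the perturbed density fills a ball, all topological requirements hold, whatever the shape
of the original support. -/
theorem isDensity_of_support_eq_ball {g : E3 → ℝ} (hc : Continuous g) (h0 : ∀ x, 0 ≤ g x) {R : ℝ}
    (hR : 0 < R) (hg : Function.support g = Metric.ball (0 : E3) R) : IsDensity g where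
  continuous := hc
  nonneg := h0
  compact_support := by
    rw [HasCompactSupport, tsupport_eq_closedBall hR hg]
    exact isCompact_closedBall _ _
  connected_support := by
    rw [tsupport_eq_closedBall hR hg]
    exact (convex_closedBall _ _).isConnected (Metric.nonempty_closedBall.2 hR.le)
  boundary := by
    refine ⟨{Metric.sphere 0 R}, finite_singleton _, pairwiseDisjoint_singleton _ _, ?_, ?_⟩
    · rintro S rfl
      exact isClosedSurface_sphere hR
    · rw [sUnion_singleton, tsupport_eq_closedBall hR hg, frontier_closedBall _ hR.ne']
  zero_mem := by
    rw [tsupport_eq_closedBall hR hg, interior_closedBall _ hR.ne']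
    exact Metric.mem_ball_self hR

theorem brillouinRadius_of_support_eq_ball {g : E3 → ℝ} {R : ℝ} (hR : 0 < R)
    (hg : Function.support g = Metric.ball (0 : E3) R) : brillouinRadius g = R := by
  rw [brillouinRadius, tsupport_eq_closedBall hR hg]
  have : {m : ℝ | Metric.closedBall (0 : E3) R ⊆ Metric.ball 0 m} = Ioi R := by
    ext m
    refine ⟨fun h => ?_, fun h => Metric.closedBall_subset_ball h⟩
    have := h (a := axisPoint R) (by rw [mem_closedBall_zero_iff, norm_axisPoint hR])
    rwa [mem_ball_zero_iff, norm_axisPoint hR] at this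
  rw [this, csInf_Ioi]

theorem IsDensity.exists_norm_le {f : E3 → ℝ} (hf : IsDensity f) :
    ∃ ρ, 0 ≤ ρ ∧ ∀ y, f y ≠ 0 → ‖y‖ ≤ ρ := by
  obtain ⟨ρ, hρ⟩ := hf.compact_support.isBounded.exists_norm_le
  exact ⟨max ρ 0, le_max_right _ _, fun y hy =>
    (hρ y (subset_tsupport f hy)).trans (le_max_left _ _)⟩

/-! ### Convergence of the expansion -/

theorem IsDensity.sheConvergesUniformlyOn {G : ℝ} {f : E3 → ℝ} (hf : IsDensity f) {s : Set E3}
    {V : E3 → ℝ} (h : TendstoUniformlyOn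
      (fun N x => ∑ n ∈ Finset.range (N + 1), multipoleTerm f n x) V atTop s) :
    SHEConvergesUniformlyOn G f s := by
  refine ⟨fun x => G * V x, ?_⟩
  have h' := (uniformContinuous_const_smul G).comp_tendstoUniformlyOn h
  refine h'.congr (Eventually.of_forall fun N x _ => ?_)
  simp only [Function.comp, smul_eq_mul]
  rw [sheTrunc_eq hf.brillouinRadius_pos.ne' hf.totalMass_pos.ne', Finset.mul_sum]

theorem IsDensity.tendsto_multipoleTerm {G : ℝ} (hG : 0 < G) {f : E3 → ℝ} (hf : IsDensity f)
    {s : Set E3} (h : SHEConvergesUniformlyOn G f s) {x : E3} (hx : x ∈ s) :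
    Tendsto (fun n => multipoleTerm f n x) atTop (nhds 0) := by
  obtain ⟨V, hV⟩ := h
  have h1 := hV.tendsto_at hx
  simp only [sheTrunc_eq hf.brillouinRadius_pos.ne' hf.totalMass_pos.ne'] at h1
  have h2 := ((h1.comp (tendsto_add_atTop_nat 1)).sub h1).const_mul G⁻¹
  rw [sub_self, mul_zero] at h2
  rw [← tendsto_add_atTop_iff_nat 1]
  refine h2.congr fun n => ?_
  rw [Function.comp_apply, Finset.sum_range_succ _ (n + 1), add_sub_cancel_left, inv_mul_cancel_left₀ hG.ne']

theorem bddBelow_convRadius (G : ℝ) (f : Density) :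
    BddBelow {r : ℝ | 0 < r ∧ SHEConvergesUniformlyOn G f.1 (Metric.closedBall (0 : E3) r)ᶜ} :=
  ⟨0, fun _ hr => hr.1.le⟩

/-- Ensures that the infimum defining `convRadius` is over a nonempty set, not the default value 0.
-/
theorem exists_sheConvergesUniformlyOn (G : ℝ) (f : Density) :
    ∃ r, 0 < r ∧ SHEConvergesUniformlyOn G f.1 (Metric.closedBall (0 : E3) r)ᶜ := by
  obtain ⟨ρ, hρ, hfρ⟩ := f.2.exists_norm_le
  have hr : 0 < 16 * ρ + 1 := by linarith
  exact ⟨_, hr, f.2.sheConvergesUniformlyOn (tendstoUniformlyOn_multipole f.2.continuous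
    f.2.compact_support hρ hfρ hr (by linarith))⟩

theorem tendsto_multipoleTerm_of_convRadius_lt {G : ℝ} (hG : 0 < G) (f : Density) {x : E3}
    (hx : convRadius G f < ‖x‖) : Tendsto (fun n => multipoleTerm f.1 n x) atTop (nhds 0) := by
  obtain ⟨r, ⟨_, hr⟩, hrx⟩ := exists_lt_of_csInf_lt (exists_sheConvergesUniformlyOn G f) hx
  exact f.2.tendsto_multipoleTerm hG hr (by simpa using hrx)

/-- The perturbation that extends a density to a ball and enlarges its convergence radius. -/
theorem exists_perturbation {G : ℝ} (hG : 0 < G) {ε : ℝ} (hε : 0 < ε) (f : Density) :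
    ∃ h : E3 → ℝ, ∀ η, 0 < η → ∃ g : Density, (∀ y, g.1 y = f.1 y + η * h y) ∧
      g ∈ descentSet G ε ∧ g ∈ radialDescentSet G ε ∧
        convRadius G f + 1 ≤ convRadius G g := by
  have hc0 : 0 ≤ convRadius G f := Real.sInf_nonneg fun r hr => hr.1.le
  set c := convRadius G f with hc
  obtain ⟨ρ, hρ, hfρ⟩ := f.2.exists_norm_le
  -- `ρ'` bounds the supports of `f` and of the half-ball density, `r` is a radius of crude
  -- convergence for their combination, and `R` exceeds `r + ε`.
  set ρ' := max ρ (c + 2) with hρ'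
  have hρ'0 : 0 < ρ' := lt_max_of_lt_right (by linarith)
  set r := 16 * ρ' + 1 with hr
  have hr0 : 0 < r := by linarith
  set R := r + ε + 1 with hR
  have hρR : ρ' < R := by linarith
  have hcR : c + 2 ≤ ρ' := le_max_right _ _
  refine ⟨fun y => coneDensity R y + halfBallDensity (c + 2) y, fun η hη => ?_⟩
  have hcone := continuous_coneDensity R
  have hhalf := continuous_halfBallDensity (c + 2)
  have hfc := f.2.continuous
  have hhalf0 : ∀ y, 0 ≤ halfBallDensity (c + 2) y := fun y =>
    mul_nonneg (le_max_right _ _) (le_max_right _ _)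
  have hcone0 : ∀ y, 0 ≤ coneDensity R y := fun y => le_max_right _ _
  have hhalf_norm : ∀ y, halfBallDensity (c + 2) y ≠ 0 → ‖y‖ ≤ ρ' := fun y hy => by
    by_contra hlt
    exact hy (by rw [halfBallDensity, coneDensity_eq_zero (by linarith), zero_mul])
  set f₂ : E3 → ℝ := fun y => f.1 y + η * halfBallDensity (c + 2) y with hf₂
  have hf₂c : Continuous f₂ := by fun_prop
  have hηc : HasCompactSupport fun y => η * halfBallDensity (c + 2) y :=
    (hasCompactSupport_halfBallDensity _).mul_left
  have hηs : HasCompactSupport fun y => η * coneDensity R y :=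
    (hasCompactSupport_coneDensity R).mul_left
  have hf₂s : HasCompactSupport f₂ := f.2.compact_support.add hηc
  have hf₂ρ : ∀ y, f₂ y ≠ 0 → ‖y‖ ≤ ρ' := fun y hy => by
    by_cases h1 : f.1 y = 0
    · refine hhalf_norm y fun h2 => hy ?_
      simp only [hf₂, h1, h2, mul_zero, add_zero]
    · exact (hfρ y h1).trans (le_max_left _ _)
  have hf₂0 : ∀ y, 0 ≤ f₂ y := fun y =>
    add_nonneg (f.2.nonneg y) (mul_nonneg hη.le (hhalf0 y))
  set g : E3 → ℝ := fun y => f₂ y + η * coneDensity R y with hg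
  have hsupp : Function.support g = Metric.ball (0 : E3) R := by
    ext y
    rw [Function.mem_support, mem_ball_zero_iff]
    refine ⟨fun hy => ?_, fun hy => ?_⟩
    · by_contra hlt
      refine hy ?_
      have h1 : f₂ y = 0 := by
        by_contra h1
        linarith [hf₂ρ y h1]
      simp only [hg, h1, coneDensity_eq_zero (not_lt.1 hlt), mul_zero, add_zero]
    · refine (add_pos_of_nonneg_of_pos (hf₂0 y) (mul_pos hη ?_)).ne'
      exact lt_max_of_lt_left (by linarith)
  have hR0 : 0 < R := by linarith
  have hgd : IsDensity g := isDensity_of_support_eq_ball (by fun_prop)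
    (fun y => add_nonneg (hf₂0 y) (mul_nonneg hη.le (hcone0 y))) hR0 hsupp
  have hgR : brillouinRadius g = R := brillouinRadius_of_support_eq_ball hR0 hsupp
  have hterm : ∀ n x, multipoleTerm g n x
      = multipoleTerm f₂ n x + η * multipoleTerm (coneDensity R) n x := fun n x => by
    rw [hg, multipoleTerm_add hf₂c hf₂s (by fun_prop) hηs, multipoleTerm_const_mul]
  have hterm₂ : ∀ n x, multipoleTerm f₂ n x
      = multipoleTerm f.1 n x + η * multipoleTerm (halfBallDensity (c + 2)) n x := fun n x => by
    rw [hf₂, multipoleTerm_add hfc f.2.compact_support (by fun_prop) hηc,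
      multipoleTerm_const_mul]
  -- The cone adds the same degree-0 term to every truncation, so the uniform estimate for `f₂`
  -- carries over unchanged.
  have hconv : SHEConvergesUniformlyOn G g (Metric.closedBall (0 : E3) r)ᶜ := by
    have h1 := tendstoUniformlyOn_multipole hf₂c hf₂s hρ'0.le hf₂ρ hr0 (by linarith)
    refine hgd.sheConvergesUniformlyOn
      (V := fun x => ∑' n, multipoleTerm f₂ n x + η * multipoleTerm (coneDensity R) 0 x) ?_
    rw [Metric.tendstoUniformlyOn_iff] at h1 ⊢
    intro δ hδ
    filter_upwards [h1 δ hδ] with N hN x hx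
    have hsum : ∑ n ∈ Finset.range (N + 1), multipoleTerm g n x
        = ∑ n ∈ Finset.range (N + 1), multipoleTerm f₂ n x
          + η * multipoleTerm (coneDensity R) 0 x := by
      simp only [hterm, Finset.sum_add_distrib]
      rw [Finset.sum_eq_single_of_mem (f := fun n => η * multipoleTerm (coneDensity R) n x) 0
        (by simp) fun n _ hn => by rw [multipoleTerm_coneDensity R hn, mul_zero]]
    rw [hsum, dist_add_right]
    exact hN x hx
  refine ⟨⟨g, hgd⟩, fun y => by simp only [hg, hf₂]; ring, ?_, ?_, ?_⟩
  · obtain ⟨V, hV⟩ := hconv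
    refine ⟨V, hV.mono fun x hx => ?_⟩
    have h1 : brillouinRadius g - ε < ‖x‖ := hx.2.1
    rw [hgR] at h1
    simp only [mem_compl_iff, mem_closedBall_zero_iff, not_le]
    linarith
  · have h1 : convRadius G ⟨g, hgd⟩ ≤ r := csInf_le (bddBelow_convRadius G _) ⟨hr0, hconv⟩
    change convRadius G ⟨g, hgd⟩ ≤ brillouinRadius g - ε
    rw [hgR]
    linarith
  · by_contra hlt
    -- If the radius of `g` were below `c + 1`, the terms of both `f` and `g` would tend to 0 at
    -- this height, hence so would those of the half ball, which is excluded below `c + 2`.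
    have hz : ‖axisPoint (c + 3 / 2)‖ = c + 3 / 2 := norm_axisPoint (by linarith)
    have h1 := tendsto_multipoleTerm_of_convRadius_lt hG ⟨g, hgd⟩ (x := axisPoint (c + 3 / 2))
      (by rw [hz]; linarith)
    have h2 := tendsto_multipoleTerm_of_convRadius_lt hG f (x := axisPoint (c + 3 / 2))
      (by rw [hz]; linarith)
    refine not_tendsto_multipoleTerm_halfBallDensity (R := c + 2) (z := c + 3 / 2)
      (by linarith) (by linarith) ?_
    have h3 := (h1.sub h2).const_mul η⁻¹
    rw [sub_zero, mul_zero] at h3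
    refine h3.congr' ?_
    filter_upwards [eventually_ge_atTop 1] with n hn
    simp only [hterm, hterm₂, multipoleTerm_coneDensity R (by omega : n ≠ 0)]
    field_simp
    ring

theorem wLpNorm_const_mul {p : ℝ} (hp : 1 ≤ p) {w : E3 → ℝ} (hw0 : ∀ x, 0 < w x) {η : ℝ}
    (hη : 0 ≤ η) (h : E3 → ℝ) : wLpNorm p w (fun x => η * h x) = η * wLpNorm p w h := by
  have hp0 : p ≠ 0 := by linarith
  have h1 : ∀ x, |η * h x| ^ p * w x = η ^ p * (|h x| ^ p * w x) := fun x => by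
    rw [abs_mul, abs_of_nonneg hη, Real.mul_rpow hη (abs_nonneg _), mul_assoc]
  have h2 : 0 ≤ ∫ x, |h x| ^ p * w x := integral_nonneg fun x =>
    mul_nonneg (Real.rpow_nonneg (abs_nonneg _) _) (hw0 x).le
  simp only [wLpNorm, h1, integral_const_mul]
  rw [Real.mul_rpow (Real.rpow_nonneg hη _) h2, one_div, Real.rpow_rpow_inv hη hp0]

theorem exists_near_of_perturbation {G : ℝ} (hG : 0 < G) {ε : ℝ} (hε : 0 < ε) {p : ℝ}
    (hp : 1 ≤ p) {w : E3 → ℝ} (hw0 : ∀ x, 0 < w x) (f : Density) {δ : ℝ} (hδ : 0 < δ) :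
    ∃ g : Density, wLpNorm p w (fun x => g.1 x - f.1 x) < δ ∧
      g ∈ descentSet G ε ∧ g ∈ radialDescentSet G ε ∧
        convRadius G f + 1 ≤ convRadius G g := by
  obtain ⟨h, hh⟩ := exists_perturbation hG hε f
  have hn : 0 ≤ wLpNorm p w h := Real.rpow_nonneg (integral_nonneg fun x =>
    mul_nonneg (Real.rpow_nonneg (abs_nonneg _) _) (hw0 x).le) _
  -- The `+ 1` avoids having to show that the norm is nonzero.
  have hη : 0 < δ / (wLpNorm p w h + 1) := by positivity
  obtain ⟨g, hg, hg'⟩ := hh _ hη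
  refine ⟨g, ?_, hg'⟩
  simp only [hg, add_sub_cancel_left]
  rw [wLpNorm_const_mul hp hw0 hη.le, div_mul_eq_mul_div, div_lt_iff₀ (by positivity)]
  nlinarith

theorem corollary2 (G : ℝ) (hG : 0 < G) (ε : ℝ) (hε : 0 < ε) (p : ℝ) (hp : 1 ≤ p)
    (w : E3 → ℝ) (hw : Continuous w) (hw0 : ∀ x, 0 < w x) :
    letI : PseudoMetricSpace Density := wLpMetric p hp w hw hw0
    (∀ f : descentSet G ε, ¬ ContinuousAt ((descentSet G ε).domRestrict (convRadius G)) f) ∧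
    (∀ f : radialDescentSet G ε,
      ¬ ContinuousAt ((radialDescentSet G ε).domRestrict (convRadius G)) f) := by
  let _ : PseudoMetricSpace Density := wLpMetric p hp w hw hw0
  -- The perturbed density lies in both descent sets, so one argument serves both; the center `f`
  -- need only be a density.
  have key : ∀ S : Set Density, (∀ g ∈ descentSet G ε, g ∈ radialDescentSet G ε → g ∈ S) →
      ∀ f : S, ¬ ContinuousAt (S.domRestrict (convRadius G)) f := by
    intro S hS f hf
    obtain ⟨δ, hδ, h⟩ := Metric.continuousAt_iff.1 hf 1 one_pos
    obtain ⟨g, hg, hg1, hg2, hgc⟩ := exists_near_of_perturbation hG hε hp hw0 f.1 hδ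
    have h1 : dist (convRadius G g) (convRadius G f.1) < 1 := h (x := ⟨g, hS g hg1 hg2⟩) hg
    rw [Real.dist_eq, abs_lt] at h1
    linarith
  exact ⟨key _ fun g hg _ => hg, key _ fun g _ hg => hg⟩
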